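/- For $n \ge 0$ let $[n]_q = 1 + q + \cdots + q^{n-1}$ and $[n]!_q = [n]_q [n-1]_q \cdots [1]_q$ (so $[0]!_q = 1$), and for $0 \le k \le n$ let $${n \brack k}_q = \frac{[n]!_q}{[k]!_q\,[n-k]!_q}.$$ Let $n \ge 2$ and $k$ be integers with $n-1 \le k \le 2n-3$. Then the rational function $$c(n,k;q) = \frac{1}{[n-1]_q}{3n-3 \brack n+k}_q {k-1 \brack n-2}_q \in \mathbb{Q}(q)$$ is a polynomial in $q$ with nonnegative integer coefficients, i.e. $c(n,k;q) \in \mathbb{N}[q]$. -/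

import Mathlib

open Polynomial

noncomputable section

/-- The `q`-integer `[n]_q = 1 + q + ⋯ + q ^ (n - 1)`, in the field `ℚ(q)` of rational functions;
the indeterminate `q` is `RatFunc.X`. -/
def qInt (n : ℕ) : RatFunc ℚ :=
  ∑ i ∈ Finset.range n, (RatFunc.X : RatFunc ℚ) ^ i

/-- The `q`-factorial `[n]!_q = [n]_q [n-1]_q ⋯ [1]_q`. -/
def qFact (n : ℕ) : RatFunc ℚ :=
  ∏ i ∈ Finset.Icc 1 n, qInt i

/-- The `q`-binomial coefficient `[n]!_q / ([k]!_q [n-k]!_q)` for `0 ≤ k ≤ n`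
(with the usual value `0` for `k > n`). -/
def qBinom (n k : ℕ) : RatFunc ℚ :=
  if k ≤ n then qFact n / (qFact k * qFact (n - k)) else 0

/-- The rational function
`c(n,k;q) = (1 / [n-1]_q) * (3n-3 choose n+k)_q * (k-1 choose n-2)_q`, for `n ≥ 2` and `k ≥ 1`. -/
def cq (n k : ℕ) : RatFunc ℚ :=
  1 / qInt (n - 1) * qBinom (3 * n - 3) (n + k) * qBinom (k - 1) (n - 2)

end

/-! Let A and B be the two q-binomials, so c = AB/[n-1]. Polynomiality is a Bézout argument modulo
[n-1]: [n+k]A is a multiple of [3n-3], hence of [n-1], and [n+k] ≡ [k+1], so [k+1]A ≡ 0; also [k]B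
is a multiple of [n-1]. Since [k+1] - q[k] = 1, [n-1] divides AB
(`qBinom_mul_qBinom_div_mem_range`).

For positivity, use (1 - q^(n-1)) c = (1 - q) AB. If AB is unimodal, the right side has nonnegative
coefficients up to the middle and nonpositive ones after it. Solving for the coefficients of c
upwards from 0 settles the lower half; as c is a polynomial, solving downwards from above its degree
settles the upper half (`coeff_nonneg_of_unimodal`).

Unimodality of AB (`card_subsetPairs_unimodal`) comes from sl₂: up to a power of q, AB counts pairs
of subsets by total sum, and a raising operator on such pairs, whose commutator with its transpose
is diagonal, is injective below the middle, as is its transpose above it. -/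

/-! ### Dimension comparison from a diagonal commutator -/

open Matrix in
/-- If `M Mᵀ - Mᵀ M` is diagonal with positive entries on `s`, and the rows of `M` indexed by `s`
are supported on `t`, then `s` has at most as many elements as `t`. -/
theorem card_le_card_of_commutator_eq_diagonal {B : Type*} [Fintype B] [DecidableEq B]
    (M : Matrix B B ℝ) (c : B → ℝ) (h : M * Mᵀ - Mᵀ * M = diagonal c) (s t : Finset B)
    (hs : ∀ b ∈ s, 0 < c b) (hst : ∀ b ∈ s, ∀ b', M b b' ≠ 0 → b' ∈ t) :
    s.card ≤ t.card := by
  classical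
  let L : (s → ℝ) →ₗ[ℝ] (t → ℝ) :=
    (M.submatrix (Subtype.val : s → B) (Subtype.val : t → B)).vecMulLinear
  have hL : Function.Injective L := by
    rw [injective_iff_map_eq_zero]
    intro v hv
    let w : B → ℝ := fun b => if hb : b ∈ s then v ⟨b, hb⟩ else 0
    have hws : ∀ b, b ∉ s → w b = 0 := fun b hb => by simp [w, hb]
    have hwM : w ᵥ* M = 0 := by
      funext b'
      have e : (w ᵥ* M) b' = ∑ b ∈ s, w b * M b b' := by
        simp only [vecMul, dotProduct]
        refine (Finset.sum_subset (Finset.subset_univ s) ?_).symm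
        intro b _ hb
        simp [hws b hb]
      rw [e]
      by_cases hb' : b' ∈ t
      · have := congrFun hv ⟨b', hb'⟩
        simp only [L, vecMulLinear_apply, vecMul, dotProduct, submatrix_apply] at this
        rw [← Finset.sum_coe_sort]
        simpa [w] using this
      · refine Finset.sum_eq_zero fun b hb => ?_
        by_contra h0
        exact hb' (hst b hb b' (right_ne_zero_of_mul h0))
    -- Pairing the commutator with `w` gives `∑ c w² = -|M w|² ≤ 0`, while `c > 0` on the support of
    -- `w`.
    have h1 : w ᵥ* (M * Mᵀ) ⬝ᵥ w = 0 := by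
      rw [← vecMul_vecMul, hwM]; simp
    have h2 : w ᵥ* (Mᵀ * M) ⬝ᵥ w = (M *ᵥ w) ⬝ᵥ (M *ᵥ w) := by
      rw [← vecMul_vecMul, vecMul_transpose, ← dotProduct_mulVec]
    have h3 : w ᵥ* diagonal c ⬝ᵥ w = ∑ b, c b * w b ^ 2 := by
      simp only [dotProduct, vecMul_diagonal]
      exact Finset.sum_congr rfl fun b _ => by ring
    rw [← h, vecMul_sub, sub_dotProduct, h1, h2] at h3
    have h4 : 0 ≤ (M *ᵥ w) ⬝ᵥ (M *ᵥ w) := Finset.sum_nonneg fun b _ => mul_self_nonneg _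
    have h5 : ∀ b ∈ Finset.univ, 0 ≤ c b * w b ^ 2 := by
      intro b _
      by_cases hb : b ∈ s
      · exact mul_nonneg (hs b hb).le (sq_nonneg _)
      · simp [hws b hb]
    have h6 : ∑ b, c b * w b ^ 2 = 0 := le_antisymm (by linarith) (Finset.sum_nonneg h5)
    funext ⟨b, hb⟩
    have h7 := (Finset.sum_eq_zero_iff_of_nonneg h5).1 h6 b (Finset.mem_univ b)
    have h8 : w b = 0 := by
      rcases mul_eq_zero.1 h7 with h | h
      · exact absurd h (hs b hb).ne'
      · exact pow_eq_zero_iff two_ne_zero |>.1 h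
    simpa [w, hb] using h8
  simpa using LinearMap.finrank_le_finrank_of_injective hL

/-! ### The sl₂ action on subsets -/

/-- The partial bijection of `Finset α` that replaces the element `a` by `b`. -/
def moveElement {α : Type*} [DecidableEq α] (a b : α) : Finset α ≃. Finset α where
  toFun S := if a ∈ S ∧ b ∉ S then some (insert b (S.erase a)) else none
  invFun S := if b ∈ S ∧ a ∉ S then some (insert a (S.erase b)) else none
  inv S T := by
    constructor <;>
    · intro h
      split_ifs at h with h1
      obtain rfl : _ = _ := Option.some.inj h
      rw [if_pos (by grind)]
      congr 1
      ext x
      grind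

theorem moveElement_eq_some {α : Type*} [DecidableEq α] {a b : α} {S T : Finset α} :
    moveElement a b S = some T ↔ a ∈ S ∧ b ∉ S ∧ T = insert b (S.erase a) := by
  change (if a ∈ S ∧ b ∉ S then some (insert b (S.erase a)) else none) = some T ↔ _
  split_ifs with h <;> grind

/-- Neither move undoes the precondition of the other; if `a = d` or `b = c`, both composites are
nowhere defined. Hence raising at `i` commutes with lowering at every `j ≠ i`, even an adjacent one.
-/
theorem moveElement_trans_comm {α : Type*} [DecidableEq α] {a b c d : α}
    (hac : a ≠ c) (hbd : b ≠ d) :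
    (moveElement a b).trans (moveElement d c) = (moveElement d c).trans (moveElement a b) := by
  apply PEquiv.ext
  intro S
  apply Option.ext
  intro T
  rw [← Option.mem_def, ← Option.mem_def, PEquiv.mem_trans, PEquiv.mem_trans]
  simp only [Option.mem_def, moveElement_eq_some]
  constructor
  · rintro ⟨_, ⟨h1, h2, rfl⟩, h3, h4, rfl⟩
    refine ⟨_, ⟨?_, ?_, rfl⟩, ?_, ?_, ?_⟩
    on_goal 5 => ext x
    all_goals grind
  · rintro ⟨_, ⟨h1, h2, rfl⟩, h3, h4, rfl⟩
    refine ⟨_, ⟨?_, ?_, rfl⟩, ?_, ?_, ?_⟩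
    on_goal 5 => ext x
    all_goals grind

theorem transpose_toMatrix_moveElement {α : Type*} [DecidableEq α] (a b : α) :
    ((moveElement a b).toMatrix : Matrix (Finset α) (Finset α) ℝ).transpose =
      (moveElement b a).toMatrix :=
  (PEquiv.toMatrix_symm (moveElement a b)).symm

theorem toMatrix_moveElement_mul_reverse {α : Type*} [Fintype α] [DecidableEq α] {a b : α}
    (hab : a ≠ b) :
    (moveElement a b).toMatrix * (moveElement b a).toMatrix =
      (Matrix.diagonal fun S => if a ∈ S ∧ b ∉ S then 1 else 0 :
        Matrix (Finset α) (Finset α) ℝ) := by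
  rw [← PEquiv.toMatrix_trans]
  ext S T
  rw [PEquiv.toMatrix_apply, Matrix.diagonal_apply, ← ite_and]
  refine if_congr ?_ rfl rfl
  rw [PEquiv.mem_trans]
  simp only [Option.mem_def, moveElement_eq_some]
  constructor
  · rintro ⟨_, ⟨h1, h2, rfl⟩, h3, h4, rfl⟩
    refine ⟨?_, h1, h2⟩
    ext x
    grind
  · rintro ⟨rfl, h1, h2⟩
    refine ⟨_, ⟨h1, h2, rfl⟩, ?_, ?_, ?_⟩
    on_goal 3 => ext x
    all_goals grind

/-- The raising operator on the subsets of `Fin (n + 1)`, in which `j` is replaced by `j + 1`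
with weight `√((j + 1) (n - j))`. -/
noncomputable def raisingMatrix (n : ℕ) : Matrix (Finset (Fin (n + 1))) (Finset (Fin (n + 1))) ℝ :=
  ∑ j : Fin n, √(((j : ℝ) + 1) * (n - j)) • (moveElement j.castSucc j.succ).toMatrix

open Matrix in
theorem raisingMatrix_commutator (n : ℕ) :
    raisingMatrix n * (raisingMatrix n)ᵀ - (raisingMatrix n)ᵀ * raisingMatrix n =
      diagonal fun S : Finset (Fin (n + 1)) => (S.card : ℝ) * n - 2 * ∑ i ∈ S, ((i : ℕ) : ℝ) := by
  have h0 : (raisingMatrix n)ᵀ =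
      ∑ j : Fin n, √(((j : ℝ) + 1) * (n - j)) • (moveElement j.succ j.castSucc).toMatrix := by
    simp [raisingMatrix, transpose_sum, transpose_smul, transpose_toMatrix_moveElement]
  have h1 : ∀ i j : Fin n,
      ((moveElement i.castSucc i.succ).toMatrix * (moveElement j.succ j.castSucc).toMatrix -
        (moveElement j.succ j.castSucc).toMatrix * (moveElement i.castSucc i.succ).toMatrix :
        Matrix (Finset (Fin (n + 1))) (Finset (Fin (n + 1))) ℝ) =
      if i = j then diagonal fun S => (if i.castSucc ∈ S then 1 else 0) -
        (if i.succ ∈ S then 1 else 0) else 0 := by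
    intro i j
    split_ifs with hij
    · subst hij
      have hne : i.castSucc ≠ i.succ := i.castSucc_lt_succ.ne
      rw [toMatrix_moveElement_mul_reverse hne, toMatrix_moveElement_mul_reverse hne.symm,
        diagonal_sub]
      congr 1
      funext S
      by_cases ha : i.castSucc ∈ S <;> by_cases hb : i.succ ∈ S <;> simp [ha, hb]
    · rw [← PEquiv.toMatrix_trans, ← PEquiv.toMatrix_trans, moveElement_trans_comm, sub_self]
      · simpa using hij
      · simpa using hij
  -- The weights are those of the irreducible (n+1)-dimensional representation: (i+1)(n-i) -
  -- i(n+1-i) = n-2i. Both sums extend to `Fin (n + 1)` because the added term vanishes, at i = n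
  -- and at i = 0 respectively.
  have h2 : ∀ S : Finset (Fin (n + 1)),
      ∑ j : Fin n, (((j : ℝ) + 1) * (n - j)) * ((if j.castSucc ∈ S then 1 else 0) -
        (if j.succ ∈ S then 1 else 0)) = (S.card : ℝ) * n - 2 * ∑ i ∈ S, ((i : ℕ) : ℝ) := by
    intro S
    have e1 : ∑ j : Fin n, (((j : ℝ) + 1) * (n - j)) * (if j.castSucc ∈ S then (1 : ℝ) else 0) =
        ∑ i : Fin (n + 1), (((i : ℝ) + 1) * (n - i)) * (if i ∈ S then (1 : ℝ) else 0) := by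
      rw [Fin.sum_univ_castSucc]; simp
    have e2 : ∑ j : Fin n, (((j : ℝ) + 1) * (n - j)) * (if j.succ ∈ S then (1 : ℝ) else 0) =
        ∑ i : Fin (n + 1), ((i : ℝ) * (n + 1 - i)) * (if i ∈ S then (1 : ℝ) else 0) := by
      rw [Fin.sum_univ_succ]
      simp
    simp only [mul_sub (_ * _), Finset.sum_sub_distrib]
    rw [e1, e2, ← Finset.sum_sub_distrib]
    have e3 : ∀ i : Fin (n + 1), (((i : ℝ) + 1) * (n - i)) * (if i ∈ S then (1 : ℝ) else 0) -
        ((i : ℝ) * (n + 1 - i)) * (if i ∈ S then (1 : ℝ) else 0) =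
        if i ∈ S then (n : ℝ) - 2 * i else 0 := by
      intro i
      split_ifs <;> ring
    rw [Finset.sum_congr rfl fun i _ => e3 i, Finset.sum_ite_mem, Finset.univ_inter,
      Finset.sum_sub_distrib, Finset.mul_sum]
    simp
  rw [h0, raisingMatrix, Finset.sum_mul_sum, Finset.sum_mul_sum]
  rw [Finset.sum_comm (s := Finset.univ) (f := fun i j : Fin n =>
    (√(((i : ℝ) + 1) * (n - i)) • (moveElement i.succ i.castSucc).toMatrix :
        Matrix (Finset (Fin (n + 1))) (Finset (Fin (n + 1))) ℝ) *
      √(((j : ℝ) + 1) * (n - j)) • (moveElement j.castSucc j.succ).toMatrix)]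
  rw [← Finset.sum_sub_distrib]
  have h3 : ∀ i : Fin n, ∑ j : Fin n,
      (√(((i : ℝ) + 1) * (n - i)) • (moveElement i.castSucc i.succ).toMatrix :
        Matrix (Finset (Fin (n + 1))) (Finset (Fin (n + 1))) ℝ) *
      √(((j : ℝ) + 1) * (n - j)) • (moveElement j.succ j.castSucc).toMatrix -
      ∑ j : Fin n, (√(((j : ℝ) + 1) * (n - j)) • (moveElement j.succ j.castSucc).toMatrix :
        Matrix (Finset (Fin (n + 1))) (Finset (Fin (n + 1))) ℝ) *
      √(((i : ℝ) + 1) * (n - i)) • (moveElement i.castSucc i.succ).toMatrix =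
      (((i : ℝ) + 1) * (n - i)) • diagonal fun S => (if i.castSucc ∈ S then 1 else 0) -
        (if i.succ ∈ S then 1 else 0) := by
    intro i
    rw [← Finset.sum_sub_distrib]
    simp only [smul_mul_smul_comm]
    have : ∀ j : Fin n, √(((j : ℝ) + 1) * (n - j)) * √(((i : ℝ) + 1) * (n - i)) =
      √(((i : ℝ) + 1) * (n - i)) * √(((j : ℝ) + 1) * (n - j)) := fun j => mul_comm _ _
    simp only [this, ← smul_sub, h1, smul_ite, smul_zero, Finset.sum_ite_eq, Finset.mem_univ,
      if_true]
    rw [Real.mul_self_sqrt]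
    have : (i : ℝ) < n := by exact_mod_cast i.2
    exact mul_nonneg (by positivity) (by linarith)
  rw [Finset.sum_congr rfl fun i _ => h3 i]
  ext S T
  rw [Matrix.sum_apply]
  by_cases hST : S = T
  · subst hST
    simpa using h2 S
  · simp [hST]

theorem raisingMatrix_ne_zero {n : ℕ} {S T : Finset (Fin (n + 1))} (h : raisingMatrix n S T ≠ 0) :
    T.card = S.card ∧ ∑ i ∈ T, (i : ℕ) = ∑ i ∈ S, (i : ℕ) + 1 := by
  rw [raisingMatrix, Matrix.sum_apply] at h
  obtain ⟨j, -, hj⟩ := Finset.exists_ne_zero_of_sum_ne_zero h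
  rw [Matrix.smul_apply, PEquiv.toMatrix_apply, smul_eq_mul] at hj
  have h1 := (ite_ne_right_iff.1 (right_ne_zero_of_mul hj)).1
  obtain ⟨ha, hb, rfl⟩ := moveElement_eq_some.1 h1
  have hb' : j.succ ∉ S.erase j.castSucc := fun h => hb (Finset.mem_of_mem_erase h)
  rw [Finset.card_insert_of_notMem hb', Finset.sum_insert hb', Finset.card_erase_add_one ha,
    ← Finset.add_sum_erase S _ ha]
  refine ⟨rfl, ?_⟩
  simp
  ring

open Matrix in
/-- For every `n` there is an operator on the subsets of `Fin n` which raises the sum of the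
elements by one, keeps the cardinality, and generates together with its transpose a
representation of `sl₂`. -/
theorem exists_raising_matrix (n : ℕ) :
    ∃ M : Matrix (Finset (Fin n)) (Finset (Fin n)) ℝ,
      (M * Mᵀ - Mᵀ * M =
        diagonal fun S : Finset (Fin n) => (S.card : ℝ) * (n - 1) - 2 * ∑ i ∈ S, ((i : ℕ) : ℝ)) ∧
      ∀ S T, M S T ≠ 0 → T.card = S.card ∧ ∑ i ∈ T, (i : ℕ) = ∑ i ∈ S, (i : ℕ) + 1 := by
  cases n with
  | zero =>
    refine ⟨0, ?_, by simp⟩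
    ext S T
    simp [Finset.eq_empty_of_isEmpty]
  | succ n =>
    exact ⟨raisingMatrix n, by simpa using raisingMatrix_commutator n,
      fun S T => raisingMatrix_ne_zero⟩

/-! ### Tensor products and unimodality -/

-- The mixed terms cancel because operators on different tensor factors commute.
open Matrix Kronecker in
theorem commutator_kronecker_sum {A B : Type*} [Fintype A] [DecidableEq A] [Fintype B]
    [DecidableEq B] {M : Matrix A A ℝ} {N : Matrix B B ℝ} {c : A → ℝ} {d : B → ℝ}
    (hM : M * Mᵀ - Mᵀ * M = diagonal c) (hN : N * Nᵀ - Nᵀ * N = diagonal d) :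
    (M ⊗ₖ 1 + 1 ⊗ₖ N) * (M ⊗ₖ 1 + 1 ⊗ₖ N)ᵀ - (M ⊗ₖ 1 + 1 ⊗ₖ N)ᵀ * (M ⊗ₖ 1 + 1 ⊗ₖ N) =
      diagonal fun p : A × B => c p.1 + d p.2 := by
  have hM' : M * Mᵀ = diagonal c + Mᵀ * M := by rw [← hM]; abel
  have hN' : N * Nᵀ = diagonal d + Nᵀ * N := by rw [← hN]; abel
  have e : (diagonal fun p : A × B => c p.1 + d p.2) =
      diagonal c ⊗ₖ (1 : Matrix B B ℝ) + (1 : Matrix A A ℝ) ⊗ₖ diagonal d := by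
    rw [← diagonal_one, ← diagonal_one, diagonal_kronecker_diagonal, diagonal_kronecker_diagonal,
      diagonal_add]
    simp
  rw [e, transpose_add, ← kroneckerMap_transpose, ← kroneckerMap_transpose,
    transpose_one, transpose_one]
  simp only [add_mul, mul_add, ← mul_kronecker_mul, mul_one, one_mul]
  rw [hM', hN', add_kronecker, kronecker_add]
  abel

/-- The pairs of a `k`-subset of `Fin n` and an `l`-subset of `Fin m` whose elements have total
sum `s`. -/
def subsetPairs (n k m l s : ℕ) : Finset (Finset (Fin n) × Finset (Fin m)) :=
  Finset.univ.filter fun p => p.1.card = k ∧ p.2.card = l ∧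
    ∑ i ∈ p.1, (i : ℕ) + ∑ i ∈ p.2, (i : ℕ) = s

open Matrix Kronecker in
/-- The numbers of such pairs form a unimodal sequence. -/
theorem card_subsetPairs_unimodal (n k m l s : ℕ) :
    ((2 * s : ℝ) < k * (n - 1 : ℝ) + l * (m - 1 : ℝ) →
      (subsetPairs n k m l s).card ≤ (subsetPairs n k m l (s + 1)).card) ∧
    (k * (n - 1 : ℝ) + l * (m - 1 : ℝ) < 2 * (s + 1 : ℝ) →
      (subsetPairs n k m l (s + 1)).card ≤ (subsetPairs n k m l s).card) := by
  obtain ⟨M, hM, hM'⟩ := exists_raising_matrix n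
  obtain ⟨N, hN, hN'⟩ := exists_raising_matrix m
  have h := commutator_kronecker_sum hM hN
  have key : ∀ p p' : Finset (Fin n) × Finset (Fin m),
      (M ⊗ₖ (1 : Matrix (Finset (Fin m)) (Finset (Fin m)) ℝ) +
        (1 : Matrix (Finset (Fin n)) (Finset (Fin n)) ℝ) ⊗ₖ N) p p' ≠ 0 →
      p'.1.card = p.1.card ∧ p'.2.card = p.2.card ∧
        ∑ i ∈ p'.1, (i : ℕ) + ∑ i ∈ p'.2, (i : ℕ) =
        ∑ i ∈ p.1, (i : ℕ) + ∑ i ∈ p.2, (i : ℕ) + 1 := by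
    rintro ⟨S, T⟩ ⟨S', T'⟩ hne
    change M S S' * (1 : Matrix _ _ ℝ) T T' + (1 : Matrix _ _ ℝ) S S' * N T T' ≠ 0 at hne
    have hor : M S S' * (1 : Matrix _ _ ℝ) T T' ≠ 0 ∨ (1 : Matrix _ _ ℝ) S S' * N T T' ≠ 0 :=
      not_and_or.1 fun hh => hne (by rw [hh.1, hh.2, add_zero])
    rcases hor with h1 | h1
    · obtain ⟨h2, h3⟩ := hM' _ _ (left_ne_zero_of_mul h1)
      obtain rfl : T = T' := by
        by_contra hT
        exact right_ne_zero_of_mul h1 (Matrix.one_apply_ne hT)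
      exact ⟨h2, rfl, by rw [h3]; exact add_right_comm _ _ _⟩
    · obtain ⟨h2, h3⟩ := hN' _ _ (right_ne_zero_of_mul h1)
      obtain rfl : S = S' := by
        by_contra hT
        exact left_ne_zero_of_mul h1 (Matrix.one_apply_ne hT)
      exact ⟨rfl, h2, by rw [h3]; exact (add_assoc _ _ _).symm⟩
  have hsum : ∀ t, ∀ p ∈ subsetPairs n k m l t,
      ∑ i ∈ p.1, ((i : ℕ) : ℝ) + ∑ i ∈ p.2, ((i : ℕ) : ℝ) = t := by
    intro t p hp
    simp only [subsetPairs, Finset.mem_filter] at hp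
    exact_mod_cast hp.2.2.2
  have hcard : ∀ t, ∀ p ∈ subsetPairs n k m l t, p.1.card = k ∧ p.2.card = l := by
    intro t p hp
    simp only [subsetPairs, Finset.mem_filter] at hp
    exact ⟨hp.2.1, hp.2.2.1⟩
  constructor
  · intro hs
    refine card_le_card_of_commutator_eq_diagonal _ _ h _ _ ?_ ?_
    · intro p hp
      rw [(hcard _ p hp).1, (hcard _ p hp).2]
      linarith [hsum _ p hp]
    · intro p hp p' hpp'
      have := key _ _ hpp'
      simp only [subsetPairs, Finset.mem_filter, Finset.mem_univ, true_and] at hp ⊢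
      omega
  · intro hs
    -- The transpose lowers the sum, and its commutator is the negated diagonal, positive past the
    -- middle.
    refine card_le_card_of_commutator_eq_diagonal
      (M ⊗ₖ (1 : Matrix (Finset (Fin m)) (Finset (Fin m)) ℝ) +
        (1 : Matrix (Finset (Fin n)) (Finset (Fin n)) ℝ) ⊗ₖ N)ᵀ _
      (by rw [transpose_transpose, ← neg_sub, h, diagonal_neg]) _ _ ?_ ?_
    · intro p hp
      rw [(hcard _ p hp).1, (hcard _ p hp).2]
      have := hsum _ p hp
      push_cast at this
      linarith
    · intro p hp p' hpp'
      have := key _ _ hpp'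
      simp only [subsetPairs, Finset.mem_filter, Finset.mem_univ, true_and] at hp ⊢
      omega

/-! ### q-integers and q-binomials in ℚ(q) -/

theorem qInt_eq_algebraMap (n : ℕ) :
    qInt n = algebraMap ℚ[X] (RatFunc ℚ) (∑ i ∈ Finset.range n, X ^ i) := by
  simp [qInt]

theorem qInt_ne_zero {n : ℕ} (hn : n ≠ 0) : qInt n ≠ 0 := by
  rw [qInt_eq_algebraMap]
  intro h
  rw [map_eq_zero_iff _ (RatFunc.algebraMap_injective ℚ)] at h
  have := congrArg (Polynomial.eval 1) h
  simp [Polynomial.eval_finsetSum, hn] at this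

theorem qInt_add (a b : ℕ) : qInt (a + b) = qInt a + RatFunc.X ^ a * qInt b := by
  simp [qInt, Finset.sum_range_add, pow_add, Finset.mul_sum]

theorem one_sub_X_mul_qInt (n : ℕ) : (1 - RatFunc.X) * qInt n = 1 - RatFunc.X ^ n := by
  rw [qInt, mul_neg_geom_sum]

theorem qFact_zero : qFact 0 = 1 := by simp [qFact]

theorem qFact_succ (n : ℕ) : qFact (n + 1) = qFact n * qInt (n + 1) := by
  rw [qFact, Finset.prod_Icc_succ_top (by omega)]
  rfl

theorem qFact_ne_zero (n : ℕ) : qFact n ≠ 0 := by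
  induction n with
  | zero => simp [qFact_zero]
  | succ n ih => rw [qFact_succ]; exact mul_ne_zero ih (qInt_ne_zero (by omega))

theorem qBinom_add_left (a b : ℕ) : qBinom (a + b) a = qFact (a + b) / (qFact a * qFact b) := by
  simp [qBinom]

theorem qBinom_self (n : ℕ) : qBinom n n = 1 := by
  simp [qBinom, qFact_zero, qFact_ne_zero]

theorem qBinom_zero_right (n : ℕ) : qBinom n 0 = 1 := by
  simp [qBinom, qFact_zero, qFact_ne_zero]

theorem qBinom_of_lt {n k : ℕ} (h : n < k) : qBinom n k = 0 := by
  simp [qBinom, h]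

theorem qBinom_succ_succ {n k : ℕ} (h : k ≤ n) :
    qBinom (n + 1) (k + 1) = qBinom n (k + 1) + RatFunc.X ^ (n - k) * qBinom n k := by
  obtain ⟨d, rfl⟩ := Nat.exists_eq_add_of_le h
  cases d with
  | zero => simp [qBinom_self, qBinom_of_lt]
  | succ d =>
    have e1 : qBinom (k + (d + 1)) (k + 1) =
        qFact (k + d + 1) / (qFact (k + 1) * qFact d) := by
      rw [show k + (d + 1) = k + 1 + d by ring, qBinom_add_left, show k + 1 + d = k + d + 1 by ring]
    have e2 : qBinom (k + (d + 1) + 1) (k + 1) =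
        qFact (k + d + 1 + 1) / (qFact (k + 1) * qFact (d + 1)) := by
      rw [show k + (d + 1) + 1 = k + 1 + (d + 1) by ring, qBinom_add_left,
        show k + 1 + (d + 1) = k + d + 1 + 1 by ring]
    rw [e1, e2, qBinom_add_left, ← add_assoc, qFact_succ (k + d + 1), qFact_succ d, qFact_succ k,
      show k + d + 1 + 1 = (d + 1) + (k + 1) by ring, qInt_add (d + 1),
      show k + d + 1 - k = d + 1 by omega]
    have := qFact_ne_zero k
    have := qFact_ne_zero d
    have := qInt_ne_zero (Nat.succ_ne_zero k)
    have := qInt_ne_zero (Nat.succ_ne_zero d)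
    simp only [Nat.succ_eq_add_one] at *
    field_simp

/-- `[k]_q (n choose k)_q = [n]_q (n-1 choose k-1)_q`. -/
theorem qInt_mul_qBinom_succ {n k : ℕ} (h : k ≤ n) :
    qInt (k + 1) * qBinom (n + 1) (k + 1) = qInt (n + 1) * qBinom n k := by
  obtain ⟨d, rfl⟩ := Nat.exists_eq_add_of_le h
  rw [show k + d + 1 = (k + 1) + d by ring, qBinom_add_left, qBinom_add_left,
    show k + 1 + d = (k + d) + 1 by ring, qFact_succ (k + d), qFact_succ k]
  have := qFact_ne_zero k
  have := qFact_ne_zero d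
  have := qInt_ne_zero (Nat.succ_ne_zero k)
  simp only [Nat.succ_eq_add_one] at *
  field_simp

/-! ### Integrality -/

/-- The inclusion of `ℤ[q]` into `ℚ(q)`. -/
noncomputable def intPolyToRatFunc : ℤ[X] →+* RatFunc ℚ :=
  (algebraMap ℚ[X] (RatFunc ℚ)).comp (Polynomial.mapRingHom (Int.castRingHom ℚ))

theorem intPolyToRatFunc_X : intPolyToRatFunc X = RatFunc.X := by
  simp [intPolyToRatFunc]

theorem intPolyToRatFunc_injective : Function.Injective intPolyToRatFunc :=
  (RatFunc.algebraMap_injective ℚ).comp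
    (Polynomial.map_injective _ (RingHom.injective_int (Int.castRingHom ℚ)))

theorem X_mem_range : (RatFunc.X : RatFunc ℚ) ∈ intPolyToRatFunc.range :=
  ⟨X, intPolyToRatFunc_X⟩

theorem qInt_mem_range (n : ℕ) : qInt n ∈ intPolyToRatFunc.range :=
  sum_mem fun _ _ => pow_mem X_mem_range _

theorem qBinom_mem_range (n k : ℕ) : qBinom n k ∈ intPolyToRatFunc.range := by
  induction n generalizing k with
  | zero =>
    cases k with
    | zero => rw [qBinom_self]; exact one_mem _
    | succ k => rw [qBinom_of_lt (by omega)]; exact zero_mem _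
  | succ n ih =>
    cases k with
    | zero => rw [qBinom_zero_right]; exact one_mem _
    | succ k =>
      by_cases h : k ≤ n
      · rw [qBinom_succ_succ h]
        exact add_mem (ih _) (mul_mem (pow_mem X_mem_range _) (ih _))
      · rw [qBinom_of_lt (by omega)]; exact zero_mem _

/-- `(3m choose k+m+1)_q (k-1 choose m-1)_q / [m]_q` is a polynomial with integer coefficients. -/
theorem qBinom_mul_qBinom_div_mem_range {m k : ℕ} (h1 : m ≤ k) (h2 : k ≤ 2 * m) :
    1 / qInt (m + 1) * qBinom (3 * (m + 1)) (m + 1 + (k + 1) + 1) * qBinom k m ∈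
      intPolyToRatFunc.range := by
  set A := qBinom (3 * (m + 1)) (m + 1 + (k + 1) + 1) with hA
  set B := qBinom k m with hB
  set A' := qBinom (3 * m + 2) (m + 1 + (k + 1)) with hA'
  set B' := qBinom (k + 1) (m + 1) with hB'
  set q : RatFunc ℚ := RatFunc.X with hq
  have hm : qInt (m + 1) ≠ 0 := qInt_ne_zero (by omega)
  have eB : qInt (m + 1) * B' = qInt (k + 1) * B := qInt_mul_qBinom_succ h1
  have eA : qInt (m + 1 + (k + 1) + 1) * A = qInt (3 * m + 2 + 1) * A' := by
    rw [← qInt_mul_qBinom_succ (by omega), hA, show 3 * (m + 1) = 3 * m + 2 + 1 by ring]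
  have e3 : qInt (3 * m + 2 + 1) =
      qInt (m + 1) * (1 + q ^ (m + 1) + q ^ (m + 1) * q ^ (m + 1)) := by
    rw [show 3 * m + 2 + 1 = (m + 1) + ((m + 1) + (m + 1)) by ring, qInt_add (m + 1),
      qInt_add (m + 1) (m + 1), ← hq]
    ring
  have eK : qInt (m + 1 + (k + 1) + 1) = qInt (m + 1) + q ^ (m + 1) * qInt (k + 2) := by
    rw [← qInt_add]; rfl
  have ek : qInt (k + 2) = 1 + q * qInt (k + 1) := by
    rw [show k + 2 = 1 + (k + 1) by ring, qInt_add]; simp [qInt, hq]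
  have em := one_sub_X_mul_qInt (m + 1)
  rw [e3, eK] at eA
  -- Explicit Bézout quotient: `ek` splits AB as [k+2]AB - q[k+1]AB. The first part is divisible by
  -- [m+1] through `eA` and q^(m+1) = 1 - (1-q)[m+1], the second through `eB`.
  have key : 1 / qInt (m + 1) * A * B =
      ((1 + q ^ (m + 1) + q ^ (m + 1) * q ^ (m + 1)) * A' - A + (1 - q) * qInt (k + 2) * A) * B
        - q * A * B' := by
    have : A * B = qInt (m + 1) * (((1 + q ^ (m + 1) + q ^ (m + 1) * q ^ (m + 1)) * A' - A +
        (1 - q) * qInt (k + 2) * A) * B - q * A * B') := by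
      linear_combination B * eA + q * A * eB + A * B * qInt (k + 2) * (-em) + A * B * (-ek)
    rw [mul_assoc, this]
    field_simp
  rw [key]
  have hX : q ∈ intPolyToRatFunc.range := X_mem_range
  have hpow : q ^ (m + 1) ∈ intPolyToRatFunc.range := pow_mem hX _
  refine sub_mem (mul_mem (add_mem (sub_mem (mul_mem (add_mem (add_mem (one_mem _) hpow)
    (mul_mem hpow hpow)) ?_) ?_) (mul_mem (mul_mem (sub_mem (one_mem _) hX)
    (qInt_mem_range _)) ?_)) ?_) (mul_mem (mul_mem hX ?_) ?_)
  all_goals exact qBinom_mem_range _ _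

/-! ### q-binomials as generating functions of subset sums -/

/-- The sum of `q ^ (∑ S)` over all `k`-element subsets `S` of `{0, …, n-1}`. -/
noncomputable def subsetSumPoly (n k : ℕ) : ℤ[X] :=
  ∑ S ∈ Finset.powersetCard k (Finset.range n), X ^ (∑ i ∈ S, i)

theorem subsetSumPoly_zero_right (n : ℕ) : subsetSumPoly n 0 = 1 := by
  simp [subsetSumPoly]

theorem subsetSumPoly_of_lt {n k : ℕ} (h : n < k) : subsetSumPoly n k = 0 := by
  rw [subsetSumPoly, Finset.powersetCard_eq_empty.2 (by simpa using h), Finset.sum_empty]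

theorem subsetSumPoly_succ_succ (n k : ℕ) :
    subsetSumPoly (n + 1) (k + 1) = subsetSumPoly n (k + 1) + X ^ n * subsetSumPoly n k := by
  have hn : ∀ S ∈ Finset.powersetCard k (Finset.range n), n ∉ S := fun S hS hnS =>
    Finset.notMem_range_self ((Finset.mem_powersetCard.1 hS).1 hnS)
  rw [subsetSumPoly, Finset.range_add_one,
    Finset.powersetCard_succ_insert Finset.notMem_range_self, Finset.sum_union,
    Finset.sum_image, subsetSumPoly, subsetSumPoly, Finset.mul_sum]
  · congr 1
    refine Finset.sum_congr rfl fun S hS => ?_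
    rw [Finset.sum_insert (hn S hS), pow_add]
  · intro S hS T hT hST
    rw [← Finset.erase_insert (hn S hS), ← Finset.erase_insert (hn T hT)]
    exact congrArg (Finset.erase · n) hST
  · rw [Finset.disjoint_left]
    intro S hS hS'
    obtain ⟨T, -, rfl⟩ := Finset.mem_image.1 hS'
    exact Finset.notMem_range_self ((Finset.mem_powersetCard.1 hS).1 (Finset.mem_insert_self n T))

/-- Both sides satisfy the same Pascal recurrence; the exponent `k.choose 2` is the least sum 0 + ⋯
+ (k-1). -/
theorem intPolyToRatFunc_subsetSumPoly (n k : ℕ) :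
    intPolyToRatFunc (subsetSumPoly n k) = RatFunc.X ^ k.choose 2 * qBinom n k := by
  induction n generalizing k with
  | zero =>
    cases k with
    | zero => simp [subsetSumPoly_zero_right, qBinom_self]
    | succ k => simp [subsetSumPoly_of_lt, qBinom_of_lt]
  | succ n ih =>
    cases k with
    | zero => simp [subsetSumPoly_zero_right, qBinom_zero_right]
    | succ k =>
      by_cases h : k ≤ n
      · rw [subsetSumPoly_succ_succ, map_add, map_mul, map_pow, intPolyToRatFunc_X, ih, ih,
          qBinom_succ_succ h, Nat.choose_succ_succ' k 1, Nat.choose_one_right]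
        have : (RatFunc.X : RatFunc ℚ) ^ n = RatFunc.X ^ k * RatFunc.X ^ (n - k) := by
          rw [← pow_add]; congr 1; omega
        rw [this]
        ring
      · rw [subsetSumPoly_of_lt (by omega), qBinom_of_lt (by omega)]; simp

theorem subsetSumPoly_eq_sum_fin (n k : ℕ) :
    subsetSumPoly n k =
      ∑ S ∈ Finset.powersetCard k (Finset.univ : Finset (Fin n)), X ^ (∑ i ∈ S, (i : ℕ)) := by
  rw [subsetSumPoly, ← Nat.Iio_eq_range, ← Fin.map_valEmbedding_univ, Finset.powersetCard_map,
    Finset.sum_map]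
  simp

/-! ### Nonnegativity of the quotient -/

/-- If `(1 - q^m) G = (1 - q) P` and the coefficients of `P` increase up to the middle and decrease
from there on, then the coefficients of `G` are nonnegative. -/
theorem coeff_nonneg_of_unimodal {m : ℕ} (hm : 0 < m) {G P : ℤ[X]}
    (h : (1 - X ^ m) * G = (1 - X) * P) (h0 : 0 ≤ P.coeff 0)
    (hP : ∃ D : ℝ, ∀ s : ℕ, ((2 * s : ℝ) < D → P.coeff s ≤ P.coeff (s + 1)) ∧
      (D < 2 * (s + 1 : ℝ) → P.coeff (s + 1) ≤ P.coeff s)) (i : ℕ) : 0 ≤ G.coeff i := by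
  obtain ⟨D, hD⟩ := hP
  have hc0 : G.coeff 0 = P.coeff 0 := by
    have := congrArg (fun Q => Polynomial.coeff Q 0) h
    simpa [sub_mul, Polynomial.coeff_X_pow_mul', hm.ne', Polynomial.mul_coeff_zero, hm.ne]
      using this
  have hc : ∀ j, G.coeff (j + 1) - (if m ≤ j + 1 then G.coeff (j + 1 - m) else 0) =
      P.coeff (j + 1) - P.coeff j := by
    intro j
    have := congrArg (fun Q => Polynomial.coeff Q (j + 1)) h
    simpa only [sub_mul, one_mul, Polynomial.coeff_sub, Polynomial.coeff_X_pow_mul',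
      Polynomial.coeff_X_mul] using this
  -- This says 2(i-1) < D: the step of `P` from i-1 to i is still an ascent.
  by_cases hi : (2 * i : ℝ) < D + 2
  · induction i using Nat.strong_induction_on with
    | _ i ih =>
      cases i with
      | zero => rw [hc0]; exact h0
      | succ j =>
        have h1 := hc j
        push_cast at hi
        have h2 := (hD j).1 (by linarith)
        split_ifs at h1 with hmj
        · have := ih (j + 1 - m) (by omega) (by
            have : ((j + 1 - m : ℕ) : ℝ) ≤ j + 1 := by
              exact_mod_cast Nat.sub_le _ _
            linarith)
          linarith
        · linarith
  -- Downward induction from above the degree, by G_i = G_{i+m} + (P_{i+m-1} - P_{i+m}).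
  · have key : ∀ d i, G.natDegree < i + d → ¬ (2 * i : ℝ) < D + 2 → 0 ≤ G.coeff i := by
      intro d
      induction d with
      | zero => intro i hi _; rw [Polynomial.coeff_eq_zero_of_natDegree_lt (by simpa using hi)]
      | succ d ih =>
        intro i hid hi
        have h1 := hc (i + m - 1)
        rw [show i + m - 1 + 1 = i + m by omega, if_pos (by omega), Nat.add_sub_cancel] at h1
        have h2 := ih (i + m) (by omega) (by push_cast; linarith [(Nat.cast_nonneg m : (0:ℝ) ≤ m)])
        have h3 := (hD (i + m - 1)).2 (by
          have : ((i + m - 1 : ℕ) : ℝ) + 1 = i + m := by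
            exact_mod_cast (show i + m - 1 + 1 = i + m by omega)
          rw [this]
          linarith [(Nat.cast_pos.2 hm : (0:ℝ) < m)])
        rw [show i + m - 1 + 1 = i + m by omega] at h3
        linarith
    exact key (G.natDegree + 1) i (by omega) hi

theorem exists_map_eq_of_coeff_nonneg {G : ℤ[X]} (h : ∀ i, 0 ≤ G.coeff i) :
    ∃ P : ℕ[X], P.map (Nat.castRingHom ℤ) = G := by
  rw [← Polynomial.mem_lifts, Polynomial.lifts_iff_coeff_lifts]
  exact fun i => ⟨(G.coeff i).toNat, by simpa using h i⟩

theorem coeff_subsetSumPoly_mul (n k m l s : ℕ) :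
    (subsetSumPoly n k * subsetSumPoly m l).coeff s = (subsetPairs n k m l s).card := by
  rw [subsetSumPoly_eq_sum_fin, subsetSumPoly_eq_sum_fin, Finset.sum_mul_sum,
    ← Finset.sum_product', Polynomial.finsetSum_coeff]
  simp only [← pow_add, Polynomial.coeff_X_pow, Finset.sum_boole]
  congr 2
  ext p
  simp only [subsetPairs, Finset.mem_filter, Finset.mem_product, Finset.mem_powersetCard_univ,
    Finset.mem_univ, true_and, and_assoc, eq_comm (a := s)]

/-- If `(1 - q) / (1 - q^m)` times a product of two `q`-binomial coefficients is a polynomial,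
then its coefficients are nonnegative. -/
theorem exists_natPoly_of_qInt_mul_eq {m : ℕ} (hm : 0 < m) (a b c d : ℕ) {G : ℤ[X]}
    (hG : qInt m * intPolyToRatFunc G = qBinom a b * qBinom c d) :
    ∃ P : ℕ[X], P.map (Nat.castRingHom ℤ) = G := by
  refine exists_map_eq_of_coeff_nonneg fun i => ?_
  -- The power of `X` relating subset sums to q-binomials goes onto `G`, where it only shifts
  -- coefficients.
  have h1 : (1 - X ^ m) * (X ^ (b.choose 2 + d.choose 2) * G) =
      (1 - X) * (subsetSumPoly a b * subsetSumPoly c d) := by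
    apply intPolyToRatFunc_injective
    simp only [map_mul, map_sub, map_one, map_pow, intPolyToRatFunc_X,
      intPolyToRatFunc_subsetSumPoly, ← one_sub_X_mul_qInt]
    rw [pow_add]
    linear_combination (1 - RatFunc.X) * RatFunc.X ^ b.choose 2 * RatFunc.X ^ d.choose 2 * hG
  have h2 := coeff_nonneg_of_unimodal hm h1 (by rw [coeff_subsetSumPoly_mul]; positivity)
    -- Twice the centre of symmetry: sums of b-subsets of {0, …, a-1} are symmetric about b(a-1)/2.
    ⟨b * (a - 1 : ℝ) + d * (c - 1 : ℝ), fun s => by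
      simp only [coeff_subsetSumPoly_mul, Nat.cast_le]
      exact card_subsetPairs_unimodal a b c d s⟩ (i + (b.choose 2 + d.choose 2))
  rwa [Polynomial.coeff_X_pow_mul] at h2

theorem proposition6p1 (n k : ℕ) (hn : 2 ≤ n) (hk : n ≤ k + 1) (hk' : k + 3 ≤ 2 * n) :
    ∃ P : ℕ[X],
      cq n k = algebraMap ℚ[X] (RatFunc ℚ) (P.map (Nat.castRingHom ℚ)) := by
  obtain ⟨m, rfl⟩ := Nat.exists_eq_add_of_le' hn
  obtain ⟨k, rfl⟩ := Nat.exists_eq_add_of_le' (show 1 ≤ k by omega)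
  have hcq : cq (m + 2) (k + 1) =
      1 / qInt (m + 1) * qBinom (3 * (m + 1)) (m + 1 + (k + 1) + 1) * qBinom k m := by
    rw [cq, show m + 2 - 1 = m + 1 by omega, show 3 * (m + 2) - 3 = 3 * (m + 1) by omega,
      show m + 2 + (k + 1) = m + 1 + (k + 1) + 1 by ring, Nat.add_sub_cancel, Nat.add_sub_cancel]
  obtain ⟨G, hG⟩ := qBinom_mul_qBinom_div_mem_range (m := m) (k := k) (by omega) (by omega)
  obtain ⟨P, hP⟩ := exists_natPoly_of_qInt_mul_eq (Nat.succ_pos m) (3 * (m + 1))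
    (m + 1 + (k + 1) + 1) k m (G := G) (by
      rw [hG]
      have := qInt_ne_zero (Nat.succ_ne_zero m)
      simp only [Nat.succ_eq_add_one] at *
      field_simp)
  refine ⟨P, ?_⟩
  rw [hcq, ← hG, ← hP, intPolyToRatFunc, RingHom.comp_apply, Polynomial.coe_mapRingHom,
    Polynomial.map_map]
  congr 2
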